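/- Let $k$ be a field of characteristic $p>0$, let $P$ be a finite poset, and let $D=J(P)$ be the set of its poset ideals, that is, of the subsets $I\subseteq P$ with $y\in I$ whenever $y\le x\in I$. Let $$R=\mathcal R_k[D]=k\Big[\,T\prod_{x\in I}X_x \;\Big|\; I\in J(P)\Big]\subseteq k[T,\,X_x\;(x\in P)]$$ be the Hibi ring of $D$, and let $\mathfrak m$ be its homogeneous maximal ideal, generated by the monomials $T\prod_{x\in I}X_x$, $I\in J(P)$. For a real number $t\ge 0$ the pair $(R,\mathfrak m^t)$ is called $F$-pure if for all large $q=p^e$ there is an element $d\in\mathfrak m^{\lceil t(q-1)\rceil}$ such that the $R$-linear map $R\to R^{1/q}$, $1\mapsto d^{1/q}$, splits; and $$\operatorname{fpt}(\mathfrak m)=\sup\{t\in\mathbb R_{\ge 0}\mid (R,\mathfrak m^t)\text{ is }F\text{-pure}\}.$$ Let $\overline P=P\cup\{-\infty,\infty\}$ be the poset obtained from $P$ by adding a least element $-\infty$ and a greatest element $\infty$, write $x\lessdot y$ if $y$ covers $x$ in $\overline P$, and let $\Sigma$ be the set of all functions $\psi:\overline P\to\mathbb R$ such that $\psi(\infty)=0$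 and $$0\le\psi(x)-\psi(y)\le 1\quad\text{whenever } x\lessdot y .$$ Then $$\operatorname{fpt}(\mathfrak m)=\max\{\psi(-\infty)\mid\psi\in\Sigma\},$$ and in particular the maximum exists. -/

import Mathlib

/-! ### `F`-purity of pairs and `F`-pure thresholds -/

section FPure

/-- The `R`-module `R^{1/q}`, `q = p ^ e`, for a ring `R` of characteristic `p`. The element `x^{1/q}`
is represented by `x : R`, and `r • x^{1/q} = (r ^ q * x)^{1/q}`; that is, this is `F^e_* R`. -/
def FrobRoot (R : Type*) (_p _e : ℕ) : Type _ := R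

instance (R : Type*) [CommRing R] (p e : ℕ) : AddCommGroup (FrobRoot R p e) :=
  inferInstanceAs (AddCommGroup R)

noncomputable instance (R : Type*) [CommRing R] (p e : ℕ) [Fact p.Prime] [CharP R p] :
    Module R (FrobRoot R p e) :=
  Module.compHom R (iterateFrobenius R p e)

/-- The element `d^{1/q}` of `R^{1/q}`, `q = p ^ e`. -/
def FrobRoot.root {R : Type*} (p e : ℕ) (d : R) : FrobRoot R p e := d

theorem FrobRoot.smul_root {R : Type*} [CommRing R] (p e : ℕ) [Fact p.Prime] [CharP R p]
    (r d : R) : r • FrobRoot.root p e d = FrobRoot.root p e (r ^ p ^ e * d) := rfl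

/-- The `R`-linear map `R → R^{1/q}`, `1 ↦ d^{1/q}`, splits. -/
def FrobRootSplits {R : Type*} [CommRing R] (p e : ℕ) [Fact p.Prime] [CharP R p] (d : R) : Prop :=
  ∃ φ : FrobRoot R p e →ₗ[R] R,
    φ ∘ₗ LinearMap.toSpanSingleton R (FrobRoot R p e) (FrobRoot.root p e d) = LinearMap.id

/-- The pair `(R, 𝔞 ^ t)` is `F`-pure: for all large `q = p ^ e` there is an element
`d ∈ 𝔞 ^ ⌈t (q - 1)⌉` such that `R → R^{1/q}`, `1 ↦ d^{1/q}`, splits. -/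
def IsFPurePair {R : Type*} [CommRing R] (p : ℕ) [Fact p.Prime] [CharP R p]
    (𝔞 : Ideal R) (t : ℝ) : Prop :=
  ∀ᶠ e : ℕ in Filter.atTop, ∃ d ∈ 𝔞 ^ ⌈t * ((p : ℝ) ^ e - 1)⌉₊, FrobRootSplits p e d

/-- The `F`-pure threshold of `𝔞`, the supremum of all `t ≥ 0` such that `(R, 𝔞 ^ t)` is `F`-pure.
The supremum is taken in the extended reals, so that no convention about empty or unbounded sets
of reals is used. -/
noncomputable def fPureThreshold {R : Type*} [CommRing R] (p : ℕ) [Fact p.Prime] [CharP R p]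
    (𝔞 : Ideal R) : EReal :=
  sSup {x : EReal | ∃ t : ℝ, 0 ≤ t ∧ IsFPurePair p 𝔞 t ∧ x = (t : EReal)}

end FPure

/-! ### Hibi rings -/

section Hibi

variable (k : Type*) [Field k] (P : Type*) [PartialOrder P] [Fintype P]

open Classical in
/-- The monomial `T * ∏_{x ∈ I} X_x` of a poset ideal (lower set) `I` of `P`. The variable `T` has
index `none` and the variable `X_x` has index `some x`. -/
noncomputable def hibiMonomial (I : LowerSet P) : MvPolynomial (Option P) k :=
  MvPolynomial.X none * ∏ x ∈ Finset.univ.filter (fun x : P => x ∈ I), MvPolynomial.X (some x)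

/-- The Hibi ring of the distributive lattice of poset ideals of `P`. -/
noncomputable def hibiRing : Subalgebra k (MvPolynomial (Option P) k) :=
  Algebra.adjoin k (Set.range (hibiMonomial k P))

instance (p : ℕ) [CharP k p] : CharP (hibiRing k P) p :=
  charP_of_injective_algebraMap (algebraMap k (hibiRing k P)).injective p

/-- The generator of the Hibi ring that belongs to the poset ideal `I`. -/
noncomputable def hibiGen (I : LowerSet P) : hibiRing k P :=
  ⟨hibiMonomial k P I, Algebra.subset_adjoin ⟨I, rfl⟩⟩

/-- The homogeneous maximal ideal `R₊` of the Hibi ring `R` (a standard graded `k`-algebra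
with the generators in degree one). -/
noncomputable def hibiMaxIdeal : Ideal (hibiRing k P) :=
  Ideal.span (Set.range (hibiGen k P))

/-- `R₊` consists of the elements of the Hibi ring without constant term. -/
theorem mem_hibiMaxIdeal_iff (f : hibiRing k P) :
    f ∈ hibiMaxIdeal k P ↔ MvPolynomial.constantCoeff (f : MvPolynomial (Option P) k) = 0 := by
  have hgen : ∀ g ∈ hibiMaxIdeal k P,
      MvPolynomial.constantCoeff (g : MvPolynomial (Option P) k) = 0 := by
    intro g hg
    have hle : hibiMaxIdeal k P ≤ RingHom.ker
        (MvPolynomial.constantCoeff.comp (hibiRing k P).val.toRingHom) := by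
      refine Ideal.span_le.2 ?_
      rintro _ ⟨I, rfl⟩
      simp [RingHom.mem_ker, hibiGen, hibiMonomial]
    exact hle hg
  have key : ∀ (g : MvPolynomial (Option P) k) (hg : g ∈ hibiRing k P),
      ∃ a : k, (⟨g, hg⟩ : hibiRing k P) - algebraMap k _ a ∈ hibiMaxIdeal k P := by
    intro g hg
    induction hg using Algebra.adjoin_induction with
    | mem x hx =>
      obtain ⟨I, rfl⟩ := hx
      refine ⟨0, ?_⟩
      rw [map_zero, sub_zero]
      exact Ideal.subset_span ⟨I, rfl⟩
    | algebraMap r =>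
      refine ⟨r, ?_⟩
      convert (hibiMaxIdeal k P).zero_mem
      exact sub_self _
    | add x y hx hy ihx ihy =>
      obtain ⟨a, ha⟩ := ihx
      obtain ⟨b, hb⟩ := ihy
      refine ⟨a + b, ?_⟩
      convert (hibiMaxIdeal k P).add_mem ha hb using 1
      rw [map_add, sub_add_sub_comm]
      rfl
    | mul x y hx hy ihx ihy =>
      obtain ⟨a, ha⟩ := ihx
      obtain ⟨b, hb⟩ := ihy
      refine ⟨a * b, ?_⟩
      have h := (hibiMaxIdeal k P).add_mem ((hibiMaxIdeal k P).mul_mem_right ⟨y, hy⟩ ha)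
        ((hibiMaxIdeal k P).mul_mem_left (algebraMap k _ a) hb)
      convert h using 1
      rw [map_mul, sub_mul, mul_sub, sub_add_sub_cancel]
      rfl
  refine ⟨hgen f, fun hf => ?_⟩
  obtain ⟨a, ha⟩ := key f f.2
  have h := hgen _ ha
  have ha0 : a = 0 := by
    have h2 : MvPolynomial.constantCoeff ((f : MvPolynomial (Option P) k) -
        MvPolynomial.C a) = 0 := h
    rw [map_sub, hf, MvPolynomial.constantCoeff_C] at h2
    simpa using h2
  rw [ha0, map_zero, sub_zero] at ha
  exact ha

/-- The set of real functions `ψ` on `P ∪ {-∞, ∞}` with `ψ ∞ = 0` and `0 ≤ ψ x - ψ y ≤ 1`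
whenever `y` covers `x`. Here `-∞` is `⊥` and `∞` is `⊤`. -/
def hibiSigma (P : Type*) [PartialOrder P] : Set (WithBot (WithTop P) → ℝ) :=
  {ψ | ψ ⊤ = 0 ∧ ∀ x y : WithBot (WithTop P), x ⋖ y → 0 ≤ ψ x - ψ y ∧ ψ x - ψ y ≤ 1}

end Hibi

/-!
The Hibi ring is the monoid algebra `k[M]` of the monoid `M` of antitone functions
`v : P ∪ {-∞, ∞} → ℕ` with `v ∞ = 0`, and `x^v` lies in `𝔪 ^ n` exactly when `n ≤ v (-∞)`. A
splitting of `1 ↦ d^{1/q}` can be read off a single monomial `x^v` of `d`, and the map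
`1 ↦ (x^v)^{1/q}` splits if and only if `v x - v y < q` whenever `y` covers `x`. Dividing such a `v`
by `q - 1` gives a point of `Σ`, so if `(R, 𝔪 ^ t)` is `F`-pure, then `t ≤ ψ (-∞)` for some `ψ ∈ Σ`.
Conversely `Σ` is stable under rounding up, so `ψ` may be taken integral, and then `v = (q - 1) ψ`
works for every `q`. Rounding up also shows that the maximum over `Σ` is attained at an integral
point.
-/

section FrobeniusSplitting

variable {R : Type*} [CommRing R] {p e : ℕ} [Fact p.Prime] [CharP R p]

theorem frobRootSplits_iff {d : R} :
    FrobRootSplits p e d ↔ ∃ φ : R →+ R, φ d = 1 ∧ ∀ r f, φ (r ^ p ^ e * f) = r * φ f := by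
  constructor
  · rintro ⟨φ, hφ⟩
    have hφd := LinearMap.congr_fun hφ 1
    rw [LinearMap.comp_apply, LinearMap.toSpanSingleton_apply, one_smul] at hφd
    exact ⟨φ.toAddMonoidHom, hφd, fun r f => φ.map_smul r (FrobRoot.root p e f)⟩
  · rintro ⟨φ, hφd, hφ⟩
    refine ⟨{ toFun := φ, map_add' := φ.map_add, map_smul' := hφ }, LinearMap.ext_ring ?_⟩
    rw [LinearMap.comp_apply, LinearMap.toSpanSingleton_apply, one_smul]
    exact hφd

theorem FrobRootSplits.map_ringEquiv {S : Type*} [CommRing S] [CharP S p] {d : R}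
    (h : FrobRootSplits p e d) (f : R ≃+* S) : FrobRootSplits p e (f d) := by
  obtain ⟨φ, hφd, hφ⟩ := frobRootSplits_iff.1 h
  refine frobRootSplits_iff.2 ⟨f.toAddMonoidHom.comp (φ.comp f.symm.toAddMonoidHom), ?_, ?_⟩
  · simp [hφd]
  · intro r g
    simp [hφ]

theorem frobRootSplits_of_ne_zero {k : Type*} [Field k] [CharP k p] {c : k} (hc : c ≠ 0) :
    FrobRootSplits p e c := by
  refine LinearMap.exists_leftInverse_of_injective _ (LinearMap.ker_eq_bot'.2 fun r hr => ?_)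
  have hr' : r ^ p ^ e * c = 0 := hr
  exact eq_zero_of_pow_eq_zero ((mul_eq_zero.1 hr').resolve_right hc)

end FrobeniusSplitting

section MonoidAlgebra

open AddMonoidAlgebra

theorem exists_addMonoidHom_single {A B M N : Type*} [Semiring A] [Semiring B] {g : M → N}
    (hg : Function.Injective g) (l : A →+ B) :
    ∃ φ : AddMonoidAlgebra A N →+ AddMonoidAlgebra B M,
      (∀ w a, φ (AddMonoidAlgebra.single (g w) a) = AddMonoidAlgebra.single w (l a)) ∧
      ∀ z a, (∀ w, g w ≠ z) → φ (AddMonoidAlgebra.single z a) = 0 := by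
  refine ⟨⟨⟨fun f => AddMonoidAlgebra.map l (comapDomain g hg f), by simp⟩, fun f f' => ?_⟩,
    fun w a => ?_, fun z a hz => ?_⟩
  · simp only [comapDomain_add, AddMonoidAlgebra.map_add]
  · change AddMonoidAlgebra.map l (comapDomain g hg _) = _
    rw [comapDomain_single_map g hg, map_single]
  · change AddMonoidAlgebra.map l (comapDomain g hg _) = _
    have hcomap : comapDomain g hg (AddMonoidAlgebra.single z a) = 0 := by
      ext w
      exact Finsupp.single_eq_of_ne (hz w)
    rw [hcomap, AddMonoidAlgebra.map_zero]

variable {k M : Type*} [CommRing k] [AddCommMonoid M]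

/-- The condition on `v` in a commutative monoid `M` under which `1 ↦ (x^v)^{1/q}` splits over the
monoid algebra `k[M]`: whenever `q u` divides `q w + v`, already `u` divides `w`. -/
def IsFrobPure (q : ℕ) (v : M) : Prop :=
  ∀ ⦃u w z : M⦄, q • w + v = q • u + z → ∃ c, w = u + c

instance (p : ℕ) [CharP k p] : CharP (AddMonoidAlgebra k M) p :=
  charP_of_injective_algebraMap
    (show Function.Injective (algebraMap k (AddMonoidAlgebra k M)) from single_right_injective) p

theorem le_of_mem_support_of_mem_pow {D : M →+ ℕ} {I : Ideal (AddMonoidAlgebra k M)}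
    (hI : ∀ f ∈ I, ∀ v ∈ f.coeff.support, 1 ≤ D v) {n : ℕ} :
    ∀ f ∈ I ^ n, ∀ v ∈ f.coeff.support, n ≤ D v := by
  classical
  induction n with
  | zero => exact fun _ _ _ _ => Nat.zero_le _
  | succ n ih =>
    intro f hf
    rw [pow_succ] at hf
    induction hf using Submodule.mul_induction_on' with
    | mem_mul_mem f hf g hg =>
      intro v hv
      obtain ⟨a, ha, b, hb, rfl⟩ := Finset.mem_add.1 (support_coeff_mul_subset f g hv)
      rw [map_add]
      exact add_le_add (ih f hf a ha) (hI g hg b hb)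
    | add f _ g _ ihf ihg =>
      intro v hv
      exact (Finset.mem_union.1 (Finsupp.support_add hv)).elim (ihf v) (ihg v)

variable {p e : ℕ} [Fact p.Prime] [CharP k p] [IsCancelAdd M]

theorem FrobRootSplits.single [IsAddTorsionFree M] {c : k} (hc : FrobRootSplits p e c) {v : M}
    (hv : IsFrobPure (p ^ e) v) : FrobRootSplits p e (AddMonoidAlgebra.single v c) := by
  obtain ⟨l, hlc, hl⟩ := frobRootSplits_iff.1 hc
  have hinj : Function.Injective fun w : M => p ^ e • w + v :=
    (add_left_injective v).comp
      (nsmul_right_injective (pow_ne_zero e (Fact.out : p.Prime).ne_zero))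
  obtain ⟨φ, hφ_image, hφ_zero⟩ := exists_addMonoidHom_single hinj l
  refine frobRootSplits_iff.2 ⟨φ, ?_, fun r f => ?_⟩
  · simpa [hlc, one_def] using hφ_image 0 c
  induction r using AddMonoidAlgebra.induction_linear with
  | zero => simp [(Fact.out : p.Prime).ne_zero]
  | add r s hr hs => rw [add_pow_char_pow, add_mul, map_add, hr, hs, add_mul]
  | single u b =>
    induction f using AddMonoidAlgebra.induction_linear with
    | zero => simp
    | add f g hf hg => rw [mul_add, map_add, hf, hg, map_add, mul_add]
    | single z a =>
      rw [single_pow, single_mul_single]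
      by_cases hz : ∃ w, p ^ e • w + v = z
      · obtain ⟨w, rfl⟩ := hz
        rw [← add_assoc, ← smul_add, hφ_image, hφ_image, hl, single_mul_single]
      · push Not at hz
        rw [hφ_zero z a hz, mul_zero]
        refine hφ_zero _ _ fun w hw => ?_
        obtain ⟨c, rfl⟩ := hv hw
        refine hz c (add_left_cancel (a := p ^ e • u) ?_)
        rw [← hw, smul_add, add_assoc]

theorem FrobRootSplits.exists_isFrobPure [Nontrivial k] {d : AddMonoidAlgebra k M}
    (h : FrobRootSplits p e d) : ∃ v ∈ d.coeff.support, IsFrobPure (p ^ e) v := by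
  obtain ⟨φ, hφd, hφ⟩ := frobRootSplits_iff.1 h
  -- Since `φ d = 1`, some term `c x^v` of `d` is mapped to an element with nonzero constant term.
  obtain ⟨v, hv, hne⟩ : ∃ v ∈ d.coeff.support,
      (φ (AddMonoidAlgebra.single v (d.coeff v))).coeff 0 ≠ 0 := by
    refine Finset.exists_ne_zero_of_sum_ne_zero ?_
    have hsum : ∑ v ∈ d.coeff.support, φ (AddMonoidAlgebra.single v (d.coeff v)) = 1 := by
      rw [← map_sum, ← hφd]
      exact congrArg φ (sum_coeff_single d)
    rw [← Finsupp.finsetSum_apply, ← coeff_sum, hsum, coeff_one_zero]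
    exact one_ne_zero
  refine ⟨v, hv, fun u w z hz => ?_⟩
  by_contra! hwu
  have hmul : AddMonoidAlgebra.single w 1 * φ (AddMonoidAlgebra.single v (d.coeff v)) =
      AddMonoidAlgebra.single u 1 * φ (AddMonoidAlgebra.single z (d.coeff v)) := by
    simp only [← hφ, single_pow, single_mul_single, hz]
  have hcoeff := congrArg (·.coeff w) hmul
  beta_reduce at hcoeff
  rw [coeff_single_mul_eq_mul_coeff 0 (by simp), one_mul,
    coeff_single_mul_of_forall_add_ne _ _ fun c hc => hwu c hc.symm] at hcoeff
  exact hne hcoeff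

end MonoidAlgebra

section HibiMonoid

variable {α : Type*}

theorem antitone_of_forall_covBy {β : Type*} [PartialOrder α] [Finite α] [Preorder β] {f : α → β}
    (h : ∀ x y, x ⋖ y → f y ≤ f x) : Antitone f := by
  classical
  cases nonempty_fintype α
  let _ := Fintype.toLocallyFiniteOrder (α := α)
  exact (antitone_iff_forall_covBy f).2 h

theorem antitone_ite {β : Type*} [Preorder α] [Preorder β] {s : α → Prop} [DecidablePred s]
    (hs : Antitone s) {a b : β} (hba : b ≤ a) : Antitone fun x => if s x then a else b := by
  intro x y hxy
  have hyx : s y → s x := hs hxy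
  dsimp only
  split_ifs with hy hx hx
  exacts [le_rfl, absurd (hyx hy) hx, hba, le_rfl]

open Classical in
theorem antitone_add_mul_of_covBy [PartialOrder α] {f : α → ℤ} (hf : Antitone f) {x y : α}
    (hxy : x ⋖ y) {q : ℕ} (hq : f y + q ≤ f x) :
    Antitone fun t => f t + q * ((if t ≤ y then 1 else 0) - if t = x then 1 else 0) := by
  intro a b hab
  have hfab := hf hab
  dsimp only
  by_cases hby : b ≤ y
  · rw [if_pos hby, if_pos (hab.trans hby)]
    by_cases hax : a = x
    · subst hax
      obtain rfl | hlt := hab.eq_or_lt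
      · exact le_rfl
      · obtain rfl : b = y := hby.eq_of_not_lt (hxy.2 hlt)
        rw [if_neg hlt.ne', if_pos rfl]
        linarith
    · rw [if_neg hax]
      split_ifs <;> linarith [q.cast_nonneg (α := ℤ)]
  · have hbx : b ≠ x := fun h => hby (h ▸ hxy.le)
    have hay : a = x → a ≤ y := fun h => h ▸ hxy.le
    rw [if_neg hby, if_neg hbx]
    split_ifs with hay' hax hax
    · linarith
    · linarith [q.cast_nonneg (α := ℤ)]
    · exact absurd (hay hax) hay'
    · linarith

/-- The monoid of antitone functions `α → ℕ` vanishing at `⊤`. For `α = P ∪ {-∞, ∞}` its elements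
are the exponent vectors of the monomials in the Hibi ring; the value at `-∞` is the exponent
of `T`. -/
def hibiMonoid (α : Type*) [Preorder α] [OrderTop α] : AddSubmonoid (α → ℕ) where
  carrier := {v | Antitone v ∧ v ⊤ = 0}
  zero_mem' := ⟨antitone_const, rfl⟩
  add_mem' hu hv := ⟨hu.1.add hv.1, by simp [hu.2, hv.2]⟩

namespace hibiMonoid

section Preorder

variable [Preorder α] [OrderTop α]

instance : IsAddTorsionFree (hibiMonoid α) :=
  Function.Injective.isAddTorsionFree (hibiMonoid α).subtype Subtype.val_injective

theorem antitone (v : hibiMonoid α) : Antitone v.1 := v.2.1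

theorem apply_top (v : hibiMonoid α) : v.1 ⊤ = 0 := v.2.2

/-- The element of the monoid obtained from an antitone integral function by subtracting its value
at `⊤`. -/
def ofAntitone (f : α → ℤ) (hf : Antitone f) : hibiMonoid α :=
  ⟨fun x => (f x - f ⊤).toNat, fun _ _ hxy => Int.toNat_le_toNat (sub_le_sub_right (hf hxy) _),
    by simp⟩

theorem coe_ofAntitone_apply {f : α → ℤ} (hf : Antitone f) (x : α) :
    ((ofAntitone f hf).1 x : ℤ) = f x - f ⊤ :=
  Int.toNat_of_nonneg (sub_nonneg.2 (hf le_top))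

theorem exists_eq_add_iff {u w : hibiMonoid α} :
    (∃ c, w = u + c) ↔ Antitone fun x => (w.1 x - u.1 x : ℤ) := by
  constructor
  · rintro ⟨c, rfl⟩ x y hxy
    simpa using antitone c hxy
  · refine fun h => ⟨ofAntitone _ h, Subtype.ext (funext fun x => ?_)⟩
    zify
    simp [coe_ofAntitone_apply, apply_top]

open Classical in
/-- The characteristic function of a proper lower set. -/
noncomputable def ofLowerSet (s : LowerSet α) (hs : ⊤ ∉ s) : hibiMonoid α :=
  ⟨fun x => if x ∈ s then 1 else 0, antitone_ite (fun _ _ h => s.lower h) zero_le_one, if_neg hs⟩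

open Classical in
theorem ofLowerSet_apply (s : LowerSet α) (hs : ⊤ ∉ s) (x : α) :
    (ofLowerSet s hs).1 x = if x ∈ s then 1 else 0 := rfl

theorem eq_zero_of_apply_bot_eq_zero [OrderBot α] {v : hibiMonoid α} (hv : v.1 ⊥ = 0) : v = 0 :=
  Subtype.ext (funext fun _ => Nat.le_zero.1 (hv ▸ antitone v bot_le))

theorem exists_eq_ofLowerSet_add [OrderBot α] {v : hibiMonoid α} (hv : v.1 ⊥ ≠ 0) :
    ∃ (s : LowerSet α) (hs : ⊤ ∉ s) (w : hibiMonoid α), ⊥ ∈ s ∧ v = ofLowerSet s hs + w := by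
  let s : LowerSet α := ⟨{x | v.1 x ≠ 0}, fun _ _ hyx hx =>
    ((Nat.pos_of_ne_zero hx).trans_le (antitone v hyx)).ne'⟩
  refine ⟨s, fun h => h (apply_top v), ⟨fun x => v.1 x - 1, fun _ _ hxy =>
    Nat.sub_le_sub_right (antitone v hxy) 1, Nat.sub_eq_zero_of_le (by simp [apply_top])⟩, hv, ?_⟩
  ext x
  have hx : x ∈ s ↔ v.1 x ≠ 0 := Iff.rfl
  simp only [AddSubmonoid.coe_add, Pi.add_apply, ofLowerSet_apply, hx]
  split_ifs <;> omega

theorem induction_ofLowerSet [OrderBot α] {motive : hibiMonoid α → Prop} (zero : motive 0)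
    (add : ∀ s hs v, ⊥ ∈ s → motive v → motive (ofLowerSet s hs + v)) (v : hibiMonoid α) :
    motive v := by
  induction hn : v.1 ⊥ generalizing v with
  | zero => rwa [eq_zero_of_apply_bot_eq_zero hn]
  | succ n ih =>
    obtain ⟨s, hs, w, hbot, rfl⟩ := exists_eq_ofLowerSet_add (hn.trans_ne n.succ_ne_zero)
    refine add s hs w hbot (ih w ?_)
    simp only [AddSubmonoid.coe_add, Pi.add_apply, ofLowerSet_apply, if_pos hbot] at hn
    omega

end Preorder

section PartialOrder

variable [PartialOrder α] [OrderTop α]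

theorem isFrobPure_of_forall_covBy [Finite α] {q : ℕ} {v : hibiMonoid α}
    (hv : ∀ x y, x ⋖ y → v.1 x < v.1 y + q) : IsFrobPure q v := by
  intro u w z h
  refine exists_eq_add_iff.2 (antitone_of_forall_covBy fun x y hxy => ?_)
  have happly (t : α) : (q * w.1 t + v.1 t : ℤ) = q * u.1 t + z.1 t := by
    exact_mod_cast congrFun (congrArg Subtype.val h) t
  have hvxy : (v.1 x : ℤ) < v.1 y + q := mod_cast hv x y hxy
  have hzxy : (z.1 y : ℤ) ≤ z.1 x := mod_cast antitone z hxy.le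
  by_contra! hlt
  have hmul := mul_le_mul_of_nonneg_left (Int.add_one_le_iff.2 hlt) (Nat.cast_nonneg (α := ℤ) q)
  linarith [happly x, happly y]

open Classical in
theorem lt_add_of_isFrobPure {q : ℕ} {v : hibiMonoid α} (hv : IsFrobPure q v) {x y : α}
    (hxy : x ⋖ y) : v.1 x < v.1 y + q := by
  by_contra! hle
  -- Up to a constant, `w - u` is `[t ≤ y] - [t = x]`: it increases from `x` to `y`, whereas
  -- `q (w - u) + v` is antitone.
  have hw : Antitone fun t => ((if t < x then 1 else 0) + if t ≤ y then 1 else 0 : ℤ) :=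
    (antitone_ite (fun _ _ h => h.trans_lt) zero_le_one).add
      (antitone_ite (fun _ _ h => h.trans) zero_le_one)
  have hz := antitone_add_mul_of_covBy (f := fun t => v.1 t)
    (Nat.mono_cast.comp_antitone (antitone v)) hxy (q := q) (mod_cast hle)
  have hx : ⊤ ∉ LowerSet.Iic x := fun h => hxy.lt.not_ge (le_top.trans h)
  have hadd : q • ofAntitone _ hw + v = q • ofLowerSet (LowerSet.Iic x) hx + ofAntitone _ hz := by
    ext t
    have hsplit : (if t ≤ x then 1 else 0 : ℤ) =
        (if t < x then 1 else 0) + if t = x then 1 else 0 := by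
      by_cases h : t = x <;> simp [le_iff_lt_or_eq, h]
    have hw_t := coe_ofAntitone_apply hw t
    have hz_t := coe_ofAntitone_apply hz t
    simp only [not_top_lt, if_false, hxy.lt.ne_top.symm, apply_top] at hw_t hz_t
    zify
    simp only [Pi.add_apply, Pi.smul_apply, smul_eq_mul, Nat.cast_add, Nat.cast_mul, hw_t, hz_t,
      ofLowerSet_apply, LowerSet.mem_Iic_iff, Nat.cast_ite, Nat.cast_one, Nat.cast_zero, hsplit]
    ring
  have h := exists_eq_add_iff.1 (hv hadd) hxy.le
  simp [coe_ofAntitone_apply, ofLowerSet_apply, hxy.le, hxy.lt.not_ge, hxy.lt.asymm] at h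

theorem isFrobPure_iff [Finite α] {q : ℕ} {v : hibiMonoid α} :
    IsFrobPure q v ↔ ∀ x y, x ⋖ y → v.1 x < v.1 y + q :=
  ⟨fun hv _ _ => lt_add_of_isFrobPure hv, isFrobPure_of_forall_covBy⟩

end PartialOrder

end hibiMonoid

end HibiMonoid

section HibiRing

open AddMonoidAlgebra hibiMonoid

variable {P : Type*} [PartialOrder P]

namespace hibiMonoid

variable [Finite P]

/-- The exponent vector, in the variables `T` (index `none`) and `X_x` (index `some x`), of the
monomial of the Hibi ring that corresponds to an element of `hibiMonoid`. -/
noncomputable def exponent : hibiMonoid (WithBot (WithTop P)) →+ (Option P →₀ ℕ) where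
  toFun v := Finsupp.equivFunOnFinite.symm fun o => v.1 (o.elim ⊥ fun x => (x : WithTop P))
  map_zero' := by ext; simp
  map_add' _ _ := by ext; simp

theorem exponent_none (v : hibiMonoid (WithBot (WithTop P))) : exponent v none = v.1 ⊥ := by
  simp [exponent]

theorem exponent_some (v : hibiMonoid (WithBot (WithTop P))) (x : P) :
    exponent v (some x) = v.1 (x : WithTop P) := by
  simp [exponent]

theorem exponent_injective : Function.Injective (exponent (P := P)) := by
  intro v w h
  ext z
  induction z with
  | bot => simpa only [exponent_none] using DFunLike.congr_fun h none
  | coe z =>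
    induction z with
    | top => exact (apply_top v).trans (apply_top w).symm
    | coe x => simpa only [exponent_some] using DFunLike.congr_fun h (some x)

end hibiMonoid

theorem exists_lowerSet_withBot_withTop (I : LowerSet P) :
    ∃ s : LowerSet (WithBot (WithTop P)), ⊤ ∉ s ∧ ⊥ ∈ s ∧
      ∀ x : P, ((x : WithTop P) : WithBot (WithTop P)) ∈ s ↔ x ∈ I := by
  refine ⟨lowerClosure (insert ⊥ ((fun x : P => ((x : WithTop P) : WithBot (WithTop P))) '' I)),
    by simp, by simp, fun x => ?_⟩
  simp only [mem_lowerClosure, Set.exists_mem_insert, Set.exists_mem_image, WithBot.coe_le_coe,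
    WithTop.coe_le_coe, le_bot_iff, WithBot.coe_ne_bot, false_or]
  exact ⟨fun ⟨_, ha, hxa⟩ => I.lower hxa ha, fun hx => ⟨x, hx, le_rfl⟩⟩

variable (k : Type*) [Field k]

/-- The embedding of the monoid algebra of `hibiMonoid` in the polynomial ring; its range is the
Hibi ring. -/
noncomputable def hibiEmbedding [Finite P] :
    AddMonoidAlgebra k (hibiMonoid (WithBot (WithTop P))) →ₐ[k] MvPolynomial (Option P) k :=
  mapDomainAlgHom k k exponent

theorem hibiEmbedding_single [Finite P] (v : hibiMonoid (WithBot (WithTop P))) (a : k) :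
    hibiEmbedding k (.single v a) = MvPolynomial.monomial (exponent v) a :=
  mapDomain_single

theorem hibiEmbedding_injective [Finite P] : Function.Injective (hibiEmbedding (P := P) k) :=
  mapDomain_injective exponent_injective

variable [Fintype P]

theorem hibiEmbedding_single_ofLowerSet {s : LowerSet (WithBot (WithTop P))} (hs : ⊤ ∉ s)
    (hbot : ⊥ ∈ s) {I : LowerSet P}
    (hI : ∀ x : P, ((x : WithTop P) : WithBot (WithTop P)) ∈ s ↔ x ∈ I) :
    hibiEmbedding k (.single (ofLowerSet s hs) 1) = hibiMonomial k P I := by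
  classical
  simp [hibiEmbedding_single, MvPolynomial.monomial_eq, Finsupp.prod_fintype, Fintype.prod_option,
    exponent_none, exponent_some, ofLowerSet_apply, hbot, hI, hibiMonomial, Finset.prod_filter,
    pow_ite]

theorem exists_hibiEmbedding_single_ofLowerSet {s : LowerSet (WithBot (WithTop P))} (hs : ⊤ ∉ s)
    (hbot : ⊥ ∈ s) :
    ∃ I, hibiEmbedding k (.single (ofLowerSet s hs) 1) = hibiMonomial k P I :=
  ⟨⟨{x | ((x : WithTop P) : WithBot (WithTop P)) ∈ s}, fun _ _ h hx => s.lower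
    (WithBot.coe_le_coe.2 (WithTop.coe_le_coe.2 h)) hx⟩,
    hibiEmbedding_single_ofLowerSet k hs hbot fun _ => Iff.rfl⟩

theorem hibiEmbedding_single_mem_hibiRing (v : hibiMonoid (WithBot (WithTop P))) (a : k) :
    hibiEmbedding k (.single v a) ∈ hibiRing k P := by
  induction v using induction_ofLowerSet with
  | zero =>
    rw [hibiEmbedding_single, map_zero]
    exact (hibiRing k P).algebraMap_mem a
  | add s hs v hbot ih =>
    obtain ⟨I, hI⟩ := exists_hibiEmbedding_single_ofLowerSet k hs hbot
    rw [← one_mul a, ← single_mul_single, map_mul, hI]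
    exact (hibiRing k P).mul_mem (hibiGen k P I).2 ih

theorem range_hibiEmbedding : (hibiEmbedding (P := P) k).range = hibiRing k P := by
  apply le_antisymm
  · rintro _ ⟨f, rfl⟩
    change hibiEmbedding k f ∈ hibiRing k P
    induction f using AddMonoidAlgebra.induction_linear with
    | zero => simp
    | add f g hf hg =>
      rw [map_add]
      exact add_mem hf hg
    | single v a => exact hibiEmbedding_single_mem_hibiRing k v a
  · refine Algebra.adjoin_le ?_
    rintro _ ⟨I, rfl⟩
    obtain ⟨s, hs, hbot, hI⟩ := exists_lowerSet_withBot_withTop I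
    exact ⟨.single (ofLowerSet s hs) 1, hibiEmbedding_single_ofLowerSet k hs hbot hI⟩

/-- The Hibi ring as the monoid algebra of `hibiMonoid`. -/
noncomputable def hibiRingEquiv :
    AddMonoidAlgebra k (hibiMonoid (WithBot (WithTop P))) ≃ₐ[k] hibiRing k P :=
  (AlgEquiv.ofInjective _ (hibiEmbedding_injective k)).trans
    (Subalgebra.equivOfEq _ _ (range_hibiEmbedding k))

theorem hibiRingEquiv_single_mem_pow (v : hibiMonoid (WithBot (WithTop P))) :
    hibiRingEquiv k (.single v 1) ∈ hibiMaxIdeal k P ^ v.1 ⊥ := by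
  induction v using induction_ofLowerSet with
  | zero => simp
  | add s hs v hbot ih =>
    obtain ⟨I, hI⟩ := exists_hibiEmbedding_single_ofLowerSet k hs hbot
    have hgen : hibiRingEquiv k (.single (ofLowerSet s hs) 1) = hibiGen k P I := Subtype.ext hI
    have hadd : (ofLowerSet s hs + v).1 ⊥ = v.1 ⊥ + 1 := by
      simp [ofLowerSet_apply, hbot, add_comm]
    rw [hadd, pow_succ', ← one_mul (1 : k), ← single_mul_single, map_mul, hgen]
    exact Ideal.mul_mem_mul (Ideal.subset_span ⟨I, rfl⟩) ih

theorem constantCoeff_hibiRingEquiv (f : AddMonoidAlgebra k (hibiMonoid (WithBot (WithTop P)))) :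
    MvPolynomial.constantCoeff (hibiRingEquiv k f : MvPolynomial (Option P) k) = f.coeff 0 := by
  have h := Finsupp.mapDomain_apply exponent_injective f.coeff 0
  rw [map_zero] at h
  exact h

theorem le_apply_bot_of_mem_hibiMaxIdeal_pow {d : hibiRing k P} {n : ℕ}
    (hd : d ∈ hibiMaxIdeal k P ^ n) {v : hibiMonoid (WithBot (WithTop P))}
    (hv : v ∈ ((hibiRingEquiv k).symm d).coeff.support) : n ≤ v.1 ⊥ := by
  have hd' : (hibiRingEquiv k).symm d ∈ (hibiMaxIdeal k P).map (hibiRingEquiv k).symm ^ n := by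
    rw [← Ideal.map_pow]
    exact Ideal.mem_map_of_mem _ hd
  refine le_of_mem_support_of_mem_pow
    (D := (Pi.evalAddMonoidHom _ ⊥).comp (hibiMonoid (WithBot (WithTop P))).subtype) ?_ _ hd' v hv
  intro f hf w hw
  obtain ⟨g, hg, rfl⟩ := (Ideal.mem_map_of_equiv _ _).1 hf
  refine Nat.one_le_iff_ne_zero.2 fun hbot => Finsupp.mem_support_iff.1 hw ?_
  have hconst := (mem_hibiMaxIdeal_iff k P g).1 hg
  rw [← (hibiRingEquiv k).apply_symm_apply g, constantCoeff_hibiRingEquiv] at hconst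
  rwa [eq_zero_of_apply_bot_eq_zero hbot]

theorem exists_mem_hibiMaxIdeal_pow_frobRootSplits_iff {p e n : ℕ} [Fact p.Prime] [CharP k p] :
    (∃ d ∈ hibiMaxIdeal k P ^ n, FrobRootSplits p e d) ↔
      ∃ v : hibiMonoid (WithBot (WithTop P)), n ≤ v.1 ⊥ ∧ ∀ x y, x ⋖ y → v.1 x < v.1 y + p ^ e := by
  constructor
  · rintro ⟨d, hd, hsplit⟩
    obtain ⟨v, hv, hpure⟩ :=
      (hsplit.map_ringEquiv (hibiRingEquiv k).symm.toRingEquiv).exists_isFrobPure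
    exact ⟨v, le_apply_bot_of_mem_hibiMaxIdeal_pow k hd hv, isFrobPure_iff.1 hpure⟩
  · rintro ⟨v, hn, hv⟩
    have hsplit : FrobRootSplits p e (1 : k) := frobRootSplits_of_ne_zero one_ne_zero
    exact ⟨hibiRingEquiv k (.single v 1),
      Ideal.pow_le_pow_right hn (hibiRingEquiv_single_mem_pow k v),
      (hsplit.single (isFrobPure_iff.2 hv)).map_ringEquiv (hibiRingEquiv k).toRingEquiv⟩

end HibiRing

section HibiSigma

variable {P : Type*} [PartialOrder P]

theorem zero_mem_hibiSigma : 0 ∈ hibiSigma P :=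
  ⟨rfl, fun _ _ _ => by simp⟩

theorem ceil_mem_hibiSigma {ψ : WithBot (WithTop P) → ℝ} (hψ : ψ ∈ hibiSigma P) :
    (fun x => (⌈ψ x⌉ : ℝ)) ∈ hibiSigma P := by
  refine ⟨by simp [hψ.1], fun x y hxy => ?_⟩
  obtain ⟨h0, h1⟩ := hψ.2 x y hxy
  have hle : ⌈ψ y⌉ ≤ ⌈ψ x⌉ := Int.ceil_mono (sub_nonneg.1 h0)
  have hle' : ⌈ψ x⌉ ≤ ⌈ψ y⌉ + 1 := by
    rw [← Int.ceil_add_one]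
    exact Int.ceil_mono (by linarith)
  rify at hle hle'
  constructor <;> linarith

variable [Finite P]

theorem antitone_of_mem_hibiSigma {ψ : WithBot (WithTop P) → ℝ} (hψ : ψ ∈ hibiSigma P) :
    Antitone ψ :=
  antitone_of_forall_covBy fun x y hxy => sub_nonneg.1 (hψ.2 x y hxy).1

theorem exists_bound_hibiSigma (x : WithBot (WithTop P)) : ∃ B : ℝ, ∀ ψ ∈ hibiSigma P, ψ x ≤ B := by
  induction x using WellFoundedGT.induction with
  | ind x ih =>
    by_cases hx : IsMax x
    · exact ⟨0, fun ψ hψ => by rw [hx.eq_top, hψ.1]⟩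
    · obtain ⟨y, hxy⟩ := exists_covBy_of_wellFoundedLT hx
      obtain ⟨B, hB⟩ := ih y hxy.lt
      exact ⟨B + 1, fun ψ hψ => by linarith [hB ψ hψ, (hψ.2 x y hxy).2]⟩

variable (P) in
theorem exists_isMaxOn_hibiSigma : ∃ ψ ∈ hibiSigma P, IsMaxOn (· ⊥) (hibiSigma P) ψ := by
  obtain ⟨B, hB⟩ := exists_bound_hibiSigma (⊥ : WithBot (WithTop P))
  obtain ⟨_, ⟨ψ, hψ, rfl⟩, hmax⟩ := Int.exists_greatest_of_bdd
    (P := fun n => ∃ ψ ∈ hibiSigma P, ⌈ψ ⊥⌉ = n)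
    ⟨⌈B⌉, by rintro _ ⟨ψ, hψ, rfl⟩; exact Int.ceil_mono (hB ψ hψ)⟩
    ⟨_, 0, zero_mem_hibiSigma, rfl⟩
  exact ⟨_, ceil_mem_hibiSigma hψ, isMaxOn_iff.2 fun χ hχ =>
    (Int.le_ceil (χ ⊥)).trans (Int.cast_le.2 (hmax _ ⟨χ, hχ, rfl⟩))⟩

end HibiSigma

section Threshold

variable {p : ℕ} [Fact p.Prime] {P : Type*} [PartialOrder P]

theorem div_mem_hibiSigma {v : hibiMonoid (WithBot (WithTop P))} {q : ℕ} (hq : 1 < q)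
    (hv : ∀ x y, x ⋖ y → v.1 x < v.1 y + q) :
    (fun x => (v.1 x / (q - 1) : ℝ)) ∈ hibiSigma P := by
  have hq' : (0 : ℝ) < q - 1 := sub_pos.2 (mod_cast hq)
  refine ⟨by simp [hibiMonoid.apply_top], fun x y hxy => ?_⟩
  have hle : (v.1 y : ℝ) ≤ v.1 x := mod_cast hibiMonoid.antitone v hxy.le
  have hlt : (v.1 x + 1 : ℝ) ≤ v.1 y + q := mod_cast hv x y hxy
  rw [← sub_div]
  exact ⟨div_nonneg (sub_nonneg.2 hle) hq'.le, (div_le_one hq').2 (by linarith)⟩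

theorem exists_hibiMonoid_of_mem_hibiSigma [Finite P] {ψ : WithBot (WithTop P) → ℝ}
    (hψ : ψ ∈ hibiSigma P) {q : ℕ} (hq : 0 < q) :
    ∃ v : hibiMonoid (WithBot (WithTop P)), (q - 1) * ψ ⊥ ≤ v.1 ⊥ ∧
      ∀ x y, x ⋖ y → v.1 x < v.1 y + q := by
  have hq' : (0 : ℝ) ≤ q - 1 := sub_nonneg.2 (mod_cast hq)
  have hf : Antitone fun x => ((q - 1) * ⌈ψ x⌉ : ℤ) := fun x y hxy =>
    mul_le_mul_of_nonneg_left (Int.ceil_mono (antitone_of_mem_hibiSigma hψ hxy)) (by omega)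
  have hv (x) : ((hibiMonoid.ofAntitone _ hf).1 x : ℝ) = (q - 1) * ⌈ψ x⌉ := by
    have h := hibiMonoid.coe_ofAntitone_apply hf x
    rw [hψ.1, Int.ceil_zero, mul_zero, sub_zero] at h
    exact_mod_cast h
  refine ⟨hibiMonoid.ofAntitone _ hf, ?_, fun x y hxy => ?_⟩
  · rw [hv]
    exact mul_le_mul_of_nonneg_left (Int.le_ceil _) hq'
  · have hle := mul_le_of_le_one_right hq' ((ceil_mem_hibiSigma hψ).2 x y hxy).2
    have hlt : ((hibiMonoid.ofAntitone _ hf).1 x : ℝ) < (hibiMonoid.ofAntitone _ hf).1 y + q := by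
      rw [hv, hv]
      linarith
    exact_mod_cast hlt

theorem isFPurePair_hibiMaxIdeal_iff [Fintype P] {k : Type*} [Field k] [CharP k p] {t : ℝ} :
    IsFPurePair p (hibiMaxIdeal k P) t ↔ ∃ ψ ∈ hibiSigma P, t ≤ ψ ⊥ := by
  simp only [IsFPurePair, exists_mem_hibiMaxIdeal_pow_frobRootSplits_iff, Nat.ceil_le]
  have hp : 1 < p := (Fact.out : p.Prime).one_lt
  constructor
  · intro h
    obtain ⟨e, ⟨v, htv, hv⟩, he⟩ := (h.and (Filter.eventually_ne_atTop 0)).exists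
    have hq : 1 < p ^ e := one_lt_pow₀ hp he
    refine ⟨_, div_mem_hibiSigma hq hv, (le_div_iff₀ (sub_pos.2 (mod_cast hq))).2 ?_⟩
    exact_mod_cast htv
  · rintro ⟨ψ, hψ, ht⟩
    refine .of_forall fun e => ?_
    obtain ⟨v, hψv, hv⟩ := exists_hibiMonoid_of_mem_hibiSigma hψ (q := p ^ e) (by positivity)
    refine ⟨v, ?_, hv⟩
    rw [Nat.cast_pow] at hψv
    have hq : (0 : ℝ) ≤ p ^ e - 1 := sub_nonneg.2 (one_le_pow₀ (mod_cast hp.le))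
    exact ((mul_comm _ _).trans_le (mul_le_mul_of_nonneg_left ht hq)).trans hψv

end Threshold

theorem theorem3p7 (p : ℕ) [Fact p.Prime] (k : Type*) [Field k] [CharP k p]
    (P : Type*) [PartialOrder P] [Fintype P] :
    IsGreatest {c : EReal | ∃ ψ ∈ hibiSigma P, c = ((ψ ⊥ : ℝ) : EReal)}
      (fPureThreshold p (hibiMaxIdeal k P)) := by
  obtain ⟨ψ, hψ, hmax⟩ := exists_isMaxOn_hibiSigma P
  have hmem : IsFPurePair p (hibiMaxIdeal k P) (ψ ⊥) :=
    isFPurePair_hibiMaxIdeal_iff.2 ⟨ψ, hψ, le_rfl⟩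
  have hthreshold : fPureThreshold p (hibiMaxIdeal k P) = (ψ ⊥ : ℝ) := by
    refine le_antisymm (sSup_le ?_) (le_sSup ⟨ψ ⊥, hmax zero_mem_hibiSigma, hmem, rfl⟩)
    rintro _ ⟨t, -, ht, rfl⟩
    obtain ⟨χ, hχ, htχ⟩ := isFPurePair_hibiMaxIdeal_iff.1 ht
    exact EReal.coe_le_coe_iff.2 (htχ.trans (hmax hχ))
  rw [hthreshold]
  refine ⟨⟨ψ, hψ, rfl⟩, ?_⟩
  rintro _ ⟨χ, hχ, rfl⟩
  exact EReal.coe_le_coe_iff.2 (hmax hχ)
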